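/- Let $X,Y$ be finite-dimensional real normed vector spaces, $f:X\to Y$ a linear map, $K\subset X$ a compact convex set, and $L=f(K)$. For a convex set $C$ and $x\in C$, let $F(x)=F_C(x)$ denote the unique face of $C$ that contains $x$ in its relative interior, where a face of $C$ is a convex subset of $C$ containing every segment in $C$ that it meets in an interior point of the segment. The set $K$ is called stable if the mid-point map $K\times K\to K$, $(x,y)\mapsto\frac12(x+y)$, is open. (A) Let $(w_i)_{i\in\mathbb N}\subset L$ converge to $w\in L$. Assume that $K$ is stable, and that a sequence $(v_i)_{i\in\mathbb N}\subset K$ converges to a point $v\in K$ such that $f(v_i)=w_i$ for all $i$ and such that $v$ lies in the relative interior of the fiber $\{x\in K\mid f(x)=w\}$. Then, for the face function $F=F_L$ of $L$: 1. for every (relatively) open subset $O\subset L$ meeting $F(w)$ there exists $N\in\mathbb N$ such that $O\cap F(w_i)\neq\emptyset$ for all $i\ge N$; 2. $\dim F(w)\le\liminf_{i\to\infty}\dim F(w_i)$. (B) Let $u_1,\dots,u_r$ be hermitian complex $d\times d$ matrices, let $\mathcal M_d$ be the set of positive semi-definite complex $d\times d$ matrices of trace one, let $\mathbb E(\rho)=(\operatorname{tr}(u_1\rho),\dots,\operatorname{tr}(u_r\rho))$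 and $L(\mathbf u)=\mathbb E(\mathcal M_d)\subset\mathbb R^r$. Let $\rho^*:L(\mathbf u)\to\mathcal M_d$ be the maximum-entropy inference, which maps $\alpha$ to the unique maximizer of the von Neumann entropy $S(\rho)=-\operatorname{tr}(\rho\ln\rho)$ on $\{\rho\in\mathcal M_d\mid\mathbb E(\rho)=\alpha\}$. If $\alpha\in L(\mathbf u)$ is the limit of a sequence of extremal points of $L(\mathbf u)$ but is not itself an extremal point of $L(\mathbf u)$, then $\rho^*$ is discontinuous at $\alpha$. -/

import Mathlib

open Filter Topology
open scoped ComplexOrder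

noncomputable section

/-! ### Faces, face function, stability -/

/-- A face of the convex set `C`: a convex subset of `C` containing every segment in `C` that it
meets in an interior point of the segment. -/
structure IsFace {V : Type*} [AddCommGroup V] [Module ℝ V] (C F : Set V) : Prop where
  convex : Convex ℝ F
  isExtreme : IsExtreme ℝ C F

/-- The face function of `C`: `faceAt C x` is the face of `C` which contains `x` in its relative
interior. There is exactly one such face if `C` is convex, `x ∈ C` and the dimension is finite
(`faceAt_spec`, `faceAt_eq`); the union only serves to select it. -/
def faceAt {V : Type*} [AddCommGroup V] [Module ℝ V] [TopologicalSpace V]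
    (C : Set V) (x : V) : Set V :=
  ⋃₀ {F | IsFace C F ∧ x ∈ intrinsicInterior ℝ F}

/-- The dimension of a nonempty convex set, i.e. the dimension of its affine hull. -/
def affineDim {V : Type*} [AddCommGroup V] [Module ℝ V] (C : Set V) : ℕ :=
  Module.finrank ℝ (affineSpan ℝ C).direction

/-- The mid-point map `C × C → C`, `(x, y) ↦ (x + y) / 2`, of a convex set. -/
def midpointMap {V : Type*} [AddCommGroup V] [Module ℝ V] {C : Set V} (hC : Convex ℝ C) :
    C × C → C :=
  fun p => ⟨midpoint ℝ (p.1 : V) (p.2 : V), hC.midpoint_mem p.1.2 p.2.2⟩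

/-- A convex set is stable if its mid-point map is open (for the subspace topologies). -/
def IsStable {V : Type*} [AddCommGroup V] [Module ℝ V] [TopologicalSpace V] {C : Set V}
    (hC : Convex ℝ C) : Prop :=
  IsOpenMap (midpointMap hC)

/-- The fiber over `w` of the restriction of `f` to `K`. -/
def fiber {A B : Type*} (f : A → B) (K : Set A) (w : B) : Set A :=
  {v ∈ K | f v = w}

/-! ### The face function is well defined -/

section FaceFunction

variable {V : Type*} [NormedAddCommGroup V] [NormedSpace ℝ V]

theorem exists_extension_of_mem_intrinsicInterior {G : Set V} {x y : V}
    (hx : x ∈ intrinsicInterior ℝ G) (hy : y ∈ G) :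
    ∃ z ∈ G, x ∈ openSegment ℝ y z := by
  obtain ⟨x', hx', rfl⟩ := mem_intrinsicInterior.1 hx
  have hyS : y ∈ affineSpan ℝ G := subset_affineSpan ℝ G hy
  let g : ℝ → affineSpan ℝ G := fun t =>
    ⟨AffineMap.lineMap (x' : V) y (-t), AffineMap.lineMap_mem _ x'.2 hyS⟩
  have hg : Continuous g := by
    refine Continuous.subtype_mk ?_ _
    simp only [AffineMap.lineMap_apply]
    fun_prop
  have h0 : g 0 = x' := by
    ext; simp [g]
  have hn : g ⁻¹' ((↑) ⁻¹' G) ∈ 𝓝 (0 : ℝ) :=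
    hg.continuousAt.preimage_mem_nhds (by rw [h0]; exact mem_interior_iff_mem_nhds.1 hx')
  obtain ⟨ε, hε, hb⟩ := Metric.mem_nhds_iff.1 hn
  have hmem : ε / 2 ∈ Metric.ball (0 : ℝ) ε := by
    simp [abs_of_pos hε]; linarith
  refine ⟨_, hb hmem, ε / 2 / (1 + ε / 2), 1 / (1 + ε / 2), by positivity, by positivity,
    by field_simp; ring, ?_⟩
  simp only [g, AffineMap.lineMap_apply, vsub_eq_sub, vadd_eq_add]
  have h1 : (1 + ε / 2) ≠ 0 := by positivity
  match_scalars <;> field_simp <;> ring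

theorem openSegment_subset_intrinsicInterior {F : Set V} (hF : Convex ℝ F) {y z : V}
    (hy : y ∈ intrinsicInterior ℝ F) (hz : z ∈ F) :
    openSegment ℝ y z ⊆ intrinsicInterior ℝ F := by
  rintro x ⟨a, b, ha, hb, hab, rfl⟩
  obtain ⟨y', hy', rfl⟩ := mem_intrinsicInterior.1 hy
  have hzS : z ∈ affineSpan ℝ F := subset_affineSpan ℝ F hz
  have hxF : a • (y' : V) + b • z ∈ F := hF (intrinsicInterior_subset hy) hz ha.le hb.le hab
  let g : affineSpan ℝ F → affineSpan ℝ F := fun p =>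
    ⟨AffineMap.lineMap z (p : V) a⁻¹, AffineMap.lineMap_mem _ hzS p.2⟩
  have hg : Continuous g := by
    refine Continuous.subtype_mk ?_ _
    simp only [AffineMap.lineMap_apply, vsub_eq_sub, vadd_eq_add]
    fun_prop
  obtain rfl : b = 1 - a := by linarith
  refine mem_intrinsicInterior.2 ⟨⟨_, subset_affineSpan ℝ F hxF⟩, ?_, rfl⟩
  refine mem_interior.2 ⟨g ⁻¹' interior ((↑) ⁻¹' F), ?_, isOpen_interior.preimage hg, ?_⟩
  · intro p hp
    have hp' : ((g p : affineSpan ℝ F) : V) ∈ F :=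
      Set.mem_preimage.1 (interior_subset (Set.mem_preimage.1 hp))
    have := hF hp' hz ha.le hb.le (by ring)
    have e : a • ((g p : affineSpan ℝ F) : V) + (1 - a) • z = p := by
      simp only [g, AffineMap.lineMap_apply, vsub_eq_sub, vadd_eq_add]
      match_scalars <;> field_simp <;> ring
    rw [e] at this
    exact this
  · have e : g ⟨_, subset_affineSpan ℝ F hxF⟩ = y' := by
      ext
      simp only [g, AffineMap.lineMap_apply, vsub_eq_sub, vadd_eq_add]
      match_scalars <;> field_simp <;> ring
    rw [Set.mem_preimage, e]
    exact hy'

/-- For a point of a convex set in finite dimension there is a unique face which contains the point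
in its relative interior. -/
theorem existsUnique_face [FiniteDimensional ℝ V] {C : Set V} (hC : Convex ℝ C) {x : V}
    (hx : x ∈ C) : ∃! F, IsFace C F ∧ x ∈ intrinsicInterior ℝ F := by
  have huniq : ∀ F G, IsFace C F → x ∈ F → IsFace C G → x ∈ intrinsicInterior ℝ G → G ⊆ F := by
    intro F G hF hxF hG hxG y hy
    obtain ⟨z, hz, hxz⟩ := exists_extension_of_mem_intrinsicInterior hxG hy
    exact hF.isExtreme.left_mem_of_mem_openSegment (hG.isExtreme.subset hy)
      (hG.isExtreme.subset hz) hxF hxz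
  let F : Set V := {y ∈ C | ∃ t : ℝ, 0 < t ∧ x + t • (x - y) ∈ C}
  have hFc : Convex ℝ F := by
    rintro y ⟨hy, s, hs, hys⟩ z ⟨hz, t, ht, hzt⟩ a b ha hb hab
    refine ⟨hC hy hz ha hb hab, s * t / (a * t + b * s), ?_, ?_⟩
    · have : 0 < a * t + b * s := by
        rcases ha.eq_or_lt with rfl | ha'
        · obtain rfl : b = 1 := by linarith
          simpa using hs
        · positivity
      positivity
    · have hD : 0 < a * t + b * s := by
        rcases ha.eq_or_lt with rfl | ha'
        · obtain rfl : b = 1 := by linarith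
          simpa using hs
        · positivity
      have := hC hys hzt (a := a * t / (a * t + b * s)) (b := b * s / (a * t + b * s))
        (by positivity) (by positivity) (by field_simp)
      convert this using 1
      obtain rfl : b = 1 - a := by linarith
      have hD' := hD.ne'
      match_scalars
      · rw [mul_one, mul_one, mul_one, div_mul_eq_mul_div, div_mul_eq_mul_div, ← add_div,
          eq_div_iff hD', add_mul, div_mul_cancel₀ _ hD']
        ring
      · field_simp
      · field_simp
  have hFe : IsExtreme ℝ C F := by
    refine ⟨fun y hy => hy.1, ?_⟩
    rintro y hy z hz p ⟨hp, t, ht, hpt⟩ ⟨a, b, ha, hb, hab, rfl⟩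
    refine ⟨hy, t * a / (1 + t * b), by positivity, ?_⟩
    have := hC hpt hz (a := 1 / (1 + t * b)) (b := t * b / (1 + t * b))
      (by positivity) (by positivity) (by field_simp)
    convert this using 1
    obtain rfl : b = 1 - a := by linarith
    have : (1 + t * (1 - a)) ≠ 0 := by positivity
    match_scalars <;> field_simp <;> ring
  have hxF : x ∈ F := ⟨hx, 1, one_pos, by simpa using hx⟩
  have hri : x ∈ intrinsicInterior ℝ F := by
    obtain ⟨y, hy⟩ := Set.Nonempty.intrinsicInterior hFc ⟨x, hxF⟩
    obtain ⟨hyC, t, ht, hyt⟩ := intrinsicInterior_subset hy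
    have hzF : x + t • (x - y) ∈ F := by
      refine ⟨hyt, t⁻¹, by positivity, ?_⟩
      convert hyC using 1
      match_scalars <;> field_simp <;> ring
    refine openSegment_subset_intrinsicInterior hFc hy hzF
      ⟨t / (1 + t), 1 / (1 + t), by positivity, by positivity, by field_simp; ring, ?_⟩
    match_scalars <;> field_simp <;> ring
  refine ⟨F, ⟨⟨hFc, hFe⟩, hri⟩, fun G hG => ?_⟩
  exact (huniq F G ⟨hFc, hFe⟩ hxF hG.1 hG.2).antisymm
    (huniq G F hG.1 (intrinsicInterior_subset hG.2) ⟨hFc, hFe⟩ hri)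

theorem faceAt_eq [FiniteDimensional ℝ V] {C F : Set V} (hC : Convex ℝ C) {x : V}
    (hx : x ∈ C) (hF : IsFace C F) (hxF : x ∈ intrinsicInterior ℝ F) : faceAt C x = F := by
  refine Set.Subset.antisymm ?_ (Set.subset_sUnion_of_mem ⟨hF, hxF⟩)
  refine Set.sUnion_subset fun G hG => ?_
  rw [(existsUnique_face hC hx).unique hG ⟨hF, hxF⟩]

theorem faceAt_spec [FiniteDimensional ℝ V] {C : Set V} (hC : Convex ℝ C) {x : V}
    (hx : x ∈ C) : IsFace C (faceAt C x) ∧ x ∈ intrinsicInterior ℝ (faceAt C x) := by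
  obtain ⟨F, hF, -⟩ := existsUnique_face hC hx
  rw [faceAt_eq hC hx hF.1 hF.2]
  exact hF

end FaceFunction

/-! ### Quantum states and the maximum-entropy inference -/

/-- The state space of the full matrix algebra: the density matrices of size `d`. -/
def stateSpace (d : ℕ) : Set (Matrix (Fin d) (Fin d) ℂ) :=
  {ρ | ρ.PosSemidef ∧ ρ.trace = 1}

/-- The expected values `(tr (u₁ a), …, tr (uᵣ a))`; these traces are real numbers for hermitian
`uᵢ` and `a`, so that taking real parts only changes the type. -/
def expectedValue {d r : ℕ} (u : Fin r → Matrix (Fin d) (Fin d) ℂ)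
    (a : Matrix (Fin d) (Fin d) ℂ) : Fin r → ℝ :=
  fun i => (u i * a).trace.re

/-- The set `L(u)` of expected values of all states. -/
def convexSupport {d r : ℕ} (u : Fin r → Matrix (Fin d) (Fin d) ℂ) : Set (Fin r → ℝ) :=
  expectedValue u '' stateSpace d

/-- The von Neumann entropy `S(ρ) = - tr (ρ ln ρ)`, with `0 ln 0 = 0`, where `ρ ln ρ` is given by
functional calculus. -/
def vonNeumannEntropy {d : ℕ} (ρ : Matrix (Fin d) (Fin d) ℂ) : ℝ :=
  -(cfc (fun x : ℝ => x * Real.log x) ρ).trace.re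

/-- The maximum-entropy inference `ρ* : L(u) → M_d`: the state of maximal von Neumann entropy among
all states with the expected values `α`. It exists by compactness and is unique by strict concavity
of the entropy, so the choice operator only names it. -/
def maxEntInference {d r : ℕ} (u : Fin r → Matrix (Fin d) (Fin d) ℂ) (α : convexSupport u) :
    Matrix (Fin d) (Fin d) ℂ :=
  Classical.epsilon fun ρ =>
    ρ ∈ fiber (expectedValue u) (stateSpace d) (α : Fin r → ℝ) ∧
      IsMaxOn vonNeumannEntropy (fiber (expectedValue u) (stateSpace d) (α : Fin r → ℝ)) ρ

end

noncomputable section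

open Matrix

/-! ### The face function through extensions of segments -/

section Faces

variable {V W : Type*} [NormedAddCommGroup V] [NormedSpace ℝ V] [FiniteDimensional ℝ V]
  [NormedAddCommGroup W] [NormedSpace ℝ W] [FiniteDimensional ℝ W]

/-! A point `y` of `C` lies in the face at `x` exactly when the segment from `y` to `x` can be
prolonged inside `C` beyond `x`. All face arguments use this criterion. For (A), stability makes the
face function of `K` lower semi-continuous: openness of the mid-point map carries points of `faceAt
K v` to nearby points of `faceAt K p` for `p` near `v` (`IsStable.eventually_inter_faceAt`). Faces
map into faces under `f`. When `v` is relatively interior to its fiber, every point of `K` over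
`F(w)` already lies in `faceAt K v` (`mem_faceAt_of_map_mem`), so lower semi-continuity descends to
`L` along the given sequence. The dimension bound follows because affine independence is an open
condition. For (B), two facts make (A) applicable. The state space is stable
(`isStable_stateSpace`): a half `B ≤ 2A` is written as `√A M √A`, and keeping `M` fixed while `A`
varies gives a continuous section of the mid-point map. The entropy maximizer is relatively interior
to its fiber, since the entropy has infinite slope towards states charging its kernel
(`diagIn_eq_zero_of_entropy_le`). If `ρ*` were continuous at `α`, its values at the extremal points
would be a lift as in (A). But the faces there are single points converging to `α`, so they stay
away from a second point of `F(α)`. -/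

theorem mem_faceAt_iff {C : Set V} (hC : Convex ℝ C) {x y : V} (hx : x ∈ C) :
    y ∈ faceAt C x ↔ y ∈ C ∧ ∃ z ∈ C, x ∈ openSegment ℝ y z := by
  obtain ⟨hF, hxF⟩ := faceAt_spec hC hx
  constructor
  · intro hy
    obtain ⟨z, hz, h⟩ := exists_extension_of_mem_intrinsicInterior hxF hy
    exact ⟨hF.isExtreme.subset hy, z, hF.isExtreme.subset hz, h⟩
  · rintro ⟨hy, z, hz, h⟩
    exact hF.isExtreme.left_mem_of_mem_openSegment hy hz (intrinsicInterior_subset hxF) h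

theorem faceAt_subset_faceAt {C : Set V} (hC : Convex ℝ C) {x y : V} (hx : x ∈ C)
    (hy : y ∈ faceAt C x) : faceAt C y ⊆ faceAt C x := by
  intro z hz
  obtain ⟨hF, -⟩ := faceAt_spec hC hx
  obtain ⟨hzC, p, hp, h⟩ := (mem_faceAt_iff hC (hF.isExtreme.subset hy)).1 hz
  exact hF.isExtreme.left_mem_of_mem_openSegment hzC hp hy h

theorem mem_intrinsicInterior_of_extension {C : Set V} (hC : Convex ℝ C) {x : V} (hx : x ∈ C)
    (h : ∀ y ∈ C, ∃ z ∈ C, x ∈ openSegment ℝ y z) : x ∈ intrinsicInterior ℝ C := by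
  have hsub : faceAt C x = C := by
    ext y
    rw [mem_faceAt_iff hC hx]
    exact ⟨fun hy => hy.1, fun hy => ⟨hy, h y hy⟩⟩
  simpa only [hsub] using (faceAt_spec hC hx).2

theorem map_mem_faceAt_image {K : Set V} (hK : Convex ℝ K) (f : V →ₗ[ℝ] W) {v x : V} (hv : v ∈ K)
    (hx : x ∈ faceAt K v) : f x ∈ faceAt (f '' K) (f v) := by
  obtain ⟨hxK, z, hz, hs⟩ := (mem_faceAt_iff hK hv).1 hx
  refine (mem_faceAt_iff (hK.linear_image f) ⟨v, hv, rfl⟩).2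
    ⟨⟨x, hxK, rfl⟩, f z, ⟨z, hz, rfl⟩, ?_⟩
  obtain ⟨a, b, ha, hb, hab, rfl⟩ := hs
  exact ⟨a, b, ha, hb, hab, by simp⟩

/-- If `v` is a relative interior point of its fiber, then the preimage in `K` of the face at `f v`
of the image is contained in the face of `K` at `v`. -/
theorem mem_faceAt_of_map_mem {K : Set V} (hK : Convex ℝ K) (f : V →ₗ[ℝ] W) {v x : V} {w : W}
    (hv : v ∈ intrinsicInterior ℝ (fiber f K w)) (hxK : x ∈ K)
    (hx : f x ∈ faceAt (f '' K) w) : x ∈ faceAt K v := by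
  have hvF : v ∈ fiber f K w := intrinsicInterior_subset hv
  obtain ⟨-, _, ⟨z, hz, rfl⟩, hs⟩ :=
    (mem_faceAt_iff (hK.linear_image f) (x := w) ⟨v, hvF⟩).1 hx
  obtain ⟨a, b, ha, hb, hab, rfl⟩ := hs
  have hpK : a • x + b • z ∈ K := hK hxK hz ha.le hb.le hab
  -- The combination of `x` and `z` is again over `w`, so it lies in the fiber, where segments
  -- ending at `v` extend. It is thus in the face at `v`, and `x` is in the face at it.
  obtain ⟨q, hq, hvq⟩ := exists_extension_of_mem_intrinsicInterior hv
    (y := a • x + b • z) ⟨hpK, by simp⟩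
  have hp : a • x + b • z ∈ faceAt K v := (mem_faceAt_iff hK hvF.1).2 ⟨hpK, q, hq.1, hvq⟩
  exact faceAt_subset_faceAt hK hvF.1 hp
    ((mem_faceAt_iff hK hpK).2 ⟨hxK, z, hz, a, b, ha, hb, hab, rfl⟩)

/-- By openness, `p` near the mid-point is itself a mid-point of some `x'` near `x` and `y'` near
`y`; such an `x'` lies in the face at `p`. -/
theorem IsStable.eventually_inter_faceAt_midpoint {K : Set V} {hK : Convex ℝ K} (h : IsStable hK) {x y : V}
    (hx : x ∈ K) (hy : y ∈ K) {U : Set V} (hU : U ∈ 𝓝 x) :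
    ∀ᶠ p in 𝓝[K] (midpoint ℝ x y), (U ∩ faceAt K p).Nonempty := by
  have hn : {q : K × K | (q.1 : V) ∈ U} ∈ 𝓝 ((⟨x, hx⟩, ⟨y, hy⟩) : K × K) :=
    (continuous_subtype_val.comp continuous_fst).continuousAt.preimage_mem_nhds hU
  have := h.image_mem_nhds hn
  rw [mem_nhds_subtype_iff_nhdsWithin] at this
  filter_upwards [this]
  rintro p ⟨p', ⟨q, hq, rfl⟩, rfl⟩
  refine ⟨q.1, hq, (mem_faceAt_iff hK (midpointMap hK q).2).2 ⟨q.1.2, q.2, q.2.2, ?_⟩⟩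
  refine ⟨1 / 2, 1 / 2, by norm_num, by norm_num, by norm_num, ?_⟩
  simp only [midpointMap, midpoint_eq_smul_add, smul_add]
  simp

/-- The face function of a stable convex set is lower semi-continuous. -/
theorem IsStable.eventually_inter_faceAt {K : Set V} {hK : Convex ℝ K} (h : IsStable hK) {v x : V}
    (hv : v ∈ K) (hx : x ∈ faceAt K v) {U : Set V} (hU : U ∈ 𝓝 x) :
    ∀ᶠ p in 𝓝[K] v, (U ∩ faceAt K p).Nonempty := by
  -- Induction on the number of halvings needed to reach the weight `a` of `x`.
  have key : ∀ (n : ℕ) (a b : ℝ) (x' : V), x ∈ K → x' ∈ K → 0 ≤ a → 0 ≤ b → a + b = 1 →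
      1 ≤ 2 ^ (n + 1) * a → ∀ᶠ p in 𝓝[K] (a • x + b • x'), (U ∩ faceAt K p).Nonempty := by
    intro n
    have half : ∀ (a b : ℝ) (x' : V), x ∈ K → x' ∈ K → 0 ≤ a → 0 ≤ b → a + b = 1 →
      1 ≤ 2 * a → ∀ᶠ p in 𝓝[K] (a • x + b • x'), (U ∩ faceAt K p).Nonempty := by
      intro a b x' hxK hx' ha hb hab h1
      -- With weight at least one half, the point is the mid-point of `x` and this point of `K`.
      have hy : (2 * a - 1) • x + (2 * b) • x' ∈ K :=
        hK hxK hx' (by linarith) (by linarith) (by linarith)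
      convert h.eventually_inter_faceAt_midpoint hxK hy hU using 2
      rw [midpoint_eq_smul_add]
      match_scalars <;> norm_num <;> ring
    induction n with
    | zero => simpa using half
    | succ n ih =>
      intro a b x' hxK hx' ha hb hab h1
      by_cases h2 : 1 ≤ 2 * a
      · exact half a b x' hxK hx' ha hb hab h2
      -- Otherwise it is the mid-point of `x'` and this point, in which the weight of `x` has
      -- doubled. The hypothesis applies to points of the face at `p` near it, and their faces are
      -- contained in the face at `p`.
      have hy : (2 * a) • x + (2 * b - 1) • x' ∈ K :=
        hK hxK hx' (by linarith) (by linarith) (by linarith)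
      have ih' := ih (2 * a) (2 * b - 1) x' hxK hx' (by linarith) (by linarith) (by linarith)
        (by rw [pow_succ] at h1; linarith)
      obtain ⟨U', hU', hsub⟩ := mem_nhdsWithin_iff_exists_mem_nhds_inter.1 ih'
      have := h.eventually_inter_faceAt_midpoint hy hx' hU'
      rw [show a • x + b • x' = midpoint ℝ ((2 * a) • x + (2 * b - 1) • x') x' by
        rw [midpoint_eq_smul_add]; match_scalars <;> norm_num <;> ring]
      filter_upwards [this, self_mem_nhdsWithin]
      rintro p ⟨q, hqU, hq⟩ hp
      obtain ⟨z, hzU, hz⟩ := hsub ⟨hqU, ((mem_faceAt_iff hK hp).1 hq).1⟩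
      exact ⟨z, hzU, faceAt_subset_faceAt hK hp hq hz⟩
  obtain ⟨hxK, x', hx', a, b, ha, hb, hab, rfl⟩ := (mem_faceAt_iff hK hv).1 hx
  obtain ⟨n, hn⟩ := pow_unbounded_of_one_lt (1 / a) (one_lt_two (α := ℝ))
  refine key n a b x' hxK hx' ha.le hb.le hab ?_
  rw [div_lt_iff₀ ha] at hn
  rw [pow_succ]
  linarith

/-- Lower semi-continuity of the face function of the image along a sequence that lifts to a
sequence converging to a relative interior point of the fiber. -/
theorem IsStable.eventually_inter_faceAt_image {K : Set V} {hK : Convex ℝ K} (h : IsStable hK)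
    (f : V →ₗ[ℝ] W) {w : ℕ → W} {w₀ : W} {v : ℕ → V} {v₀ : V} (hv : ∀ i, v i ∈ K)
    (hlim : Tendsto v atTop (𝓝 v₀)) (hvw : ∀ i, f (v i) = w i)
    (hv₀ : v₀ ∈ intrinsicInterior ℝ (fiber f K w₀)) {y : W} (hy : y ∈ faceAt (f '' K) w₀)
    {U : Set W} (hU : U ∈ 𝓝 y) : ∀ᶠ i in atTop, (U ∩ faceAt (f '' K) (w i)).Nonempty := by
  have hv₀F : v₀ ∈ fiber f K w₀ := intrinsicInterior_subset hv₀
  obtain ⟨⟨x, hxK, rfl⟩, -⟩ := (mem_faceAt_iff (hK.linear_image f) (x := w₀) ⟨v₀, hv₀F⟩).1 hy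
  have hx := mem_faceAt_of_map_mem hK f hv₀ hxK hy
  have hU' : f ⁻¹' U ∈ 𝓝 x :=
    f.continuous_of_finiteDimensional.continuousAt.preimage_mem_nhds hU
  have hlim' : Tendsto v atTop (𝓝[K] v₀) :=
    tendsto_nhdsWithin_iff.2 ⟨hlim, Eventually.of_forall hv⟩
  filter_upwards [hlim'.eventually (h.eventually_inter_faceAt hv₀F.1 hx hU')]
  rintro i ⟨z, hzU, hz⟩
  exact ⟨f z, hzU, hvw i ▸ map_mem_faceAt_image hK f (hv i) hz⟩

/-! ### Dimension through affinely independent tuples -/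

theorem exists_affineIndependent_of_nonempty {s : Set V} (hs : s.Nonempty) :
    ∃ p : Fin (affineDim s + 1) → V, (∀ i, p i ∈ s) ∧ AffineIndependent ℝ p := by
  obtain ⟨t, hts, hspan, hind⟩ := exists_affineIndependent ℝ V s
  have htfin : Finite t := finite_of_fin_dim_affineIndependent ℝ hind
  have : Fintype t := Fintype.ofFinite t
  have hne : Nonempty t := by
    rw [Set.nonempty_coe_sort, ← affineSpan_nonempty ℝ, hspan, affineSpan_nonempty]
    exact hs
  have hcard : Fintype.card t = affineDim s + 1 := by
    have h1 : 0 < Fintype.card t := Fintype.card_pos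
    have h2 := hind.finrank_vectorSpan (n := Fintype.card t - 1) (Nat.sub_add_cancel h1).symm
    rw [Subtype.range_coe, ← direction_affineSpan, hspan] at h2
    unfold affineDim
    omega
  let e := (Fintype.equivFinOfCardEq hcard).symm
  exact ⟨fun i => e i, fun i => hts (e i).2, hind.comp_embedding e.toEmbedding⟩

theorem le_affineDim_of_affineIndependent {s : Set V} {n : ℕ} {p : Fin (n + 1) → V}
    (hp : ∀ i, p i ∈ s) (hind : AffineIndependent ℝ p) : n ≤ affineDim s := by
  rw [← hind.finrank_vectorSpan (Fintype.card_fin _), affineDim, direction_affineSpan]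
  exact Submodule.finrank_mono (vectorSpan_mono ℝ (Set.range_subset_iff.2 hp))

/-- A maximal affinely independent tuple in the face at `w₀` is approximated, entry by entry, by
tuples in the faces at `w i`, which are eventually affinely independent too. -/
theorem IsStable.affineDim_faceAt_le_liminf {K : Set V} {hK : Convex ℝ K} (h : IsStable hK)
    (f : V →ₗ[ℝ] W) {w : ℕ → W} {w₀ : W} {v : ℕ → V} {v₀ : V} (hv : ∀ i, v i ∈ K)
    (hlim : Tendsto v atTop (𝓝 v₀)) (hvw : ∀ i, f (v i) = w i)
    (hv₀ : v₀ ∈ intrinsicInterior ℝ (fiber f K w₀)) :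
    (affineDim (faceAt (f '' K) w₀) : ℕ∞) ≤
      liminf (fun i => (affineDim (faceAt (f '' K) (w i)) : ℕ∞)) atTop := by
  have hv₀F : v₀ ∈ fiber f K w₀ := intrinsicInterior_subset hv₀
  obtain ⟨p, hpF, hind⟩ := exists_affineIndependent_of_nonempty
    ⟨w₀, intrinsicInterior_subset (faceAt_spec (hK.linear_image f) (x := w₀) ⟨v₀, hv₀F⟩).2⟩
  have hopen := (isOpen_setOfPred_affineIndependent (𝕜 := ℝ) (E := W)
    (ι := Fin (affineDim (faceAt (f '' K) w₀) + 1))).mem_nhds hind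
  rw [nhds_pi, mem_pi'] at hopen
  obtain ⟨I, U, hU, hsub⟩ := hopen
  refine le_liminf_of_le (by isBoundedDefault) ?_
  filter_upwards [eventually_all.2 fun j =>
    h.eventually_inter_faceAt_image f hv hlim hvw hv₀ (hpF j) (hU j)] with i hi
  choose q hqU hq using hi
  exact_mod_cast le_affineDim_of_affineIndependent hq (hsub fun j _ => hqU j)

end Faces

/-! ### The state space is a stable compact convex set -/

section StateSpace

variable {d : ℕ}

theorem Matrix.PosSemidef.exists_eq_conjTranspose_mul_self {A : Matrix (Fin d) (Fin d) ℂ}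
    (hA : A.PosSemidef) : ∃ B : Matrix (Fin d) (Fin d) ℂ, A = Bᴴ * B := by
  open scoped MatrixOrder in
  exact CStarAlgebra.nonneg_iff_eq_star_mul_self.mp hA.nonneg

/-- Exhibits the states as the continuous image of the Frobenius unit sphere, whence compactness. -/
theorem stateSpace_eq_image :
    stateSpace d = (fun B : Matrix (Fin d) (Fin d) ℂ => Bᴴ * B) '' {B | (Bᴴ * B).trace = 1} := by
  ext A
  constructor
  · rintro ⟨hA, h1⟩
    obtain ⟨B, rfl⟩ := hA.exists_eq_conjTranspose_mul_self
    exact ⟨B, h1, rfl⟩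
  · rintro ⟨B, hB, rfl⟩
    exact ⟨posSemidef_conjTranspose_mul_self B, hB⟩

theorem re_trace_conjTranspose_mul_self (B : Matrix (Fin d) (Fin d) ℂ) :
    (Bᴴ * B).trace.re = ∑ j, ∑ i, ‖B i j‖ ^ 2 := by
  simp only [trace, diag_apply, mul_apply, conjTranspose_apply, Complex.re_sum]
  refine Finset.sum_congr rfl fun j _ => Finset.sum_congr rfl fun i _ => ?_
  rw [Complex.star_def, mul_comm, Complex.mul_conj, Complex.ofReal_re, Complex.normSq_eq_norm_sq]

theorem isCompact_stateSpace : IsCompact (stateSpace d) := by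
  rw [stateSpace_eq_image]
  refine IsCompact.image ?_ (by fun_prop)
  have hclosed : IsClosed {B : Matrix (Fin d) (Fin d) ℂ | (Bᴴ * B).trace = 1} :=
    isClosed_eq (by fun_prop) continuous_const
  have hbig : IsCompact (Set.univ.pi fun _ : Fin d => Set.univ.pi fun _ : Fin d =>
      Metric.closedBall (0 : ℂ) 1) :=
    isCompact_univ_pi fun _ => isCompact_univ_pi fun _ => isCompact_closedBall _ _
  refine hbig.of_isClosed_subset hclosed ?_
  intro (B : Matrix (Fin d) (Fin d) ℂ) hB i _ j _
  have h1 : ∑ j, ∑ i, ‖B i j‖ ^ 2 = 1 := by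
    rw [← re_trace_conjTranspose_mul_self, show (Bᴴ * B).trace = 1 from hB, Complex.one_re]
  have h2 : ‖B i j‖ ^ 2 ≤ 1 := by
    rw [← h1]
    refine (Finset.single_le_sum (f := fun i => ‖B i j‖ ^ 2) (fun _ _ => by positivity)
      (Finset.mem_univ i)).trans ?_
    exact Finset.single_le_sum (f := fun j => ∑ i, ‖B i j‖ ^ 2) (fun _ _ => by positivity)
      (Finset.mem_univ j)
  rw [mem_closedBall_zero_iff]
  exact (sq_le_one_iff₀ (norm_nonneg _)).1 h2

theorem convex_stateSpace : Convex ℝ (stateSpace d) := by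
  rintro A ⟨hA, hA1⟩ B ⟨hB, hB1⟩ a b ha hb hab
  refine ⟨(hA.smul ha).add (hB.smul hb), ?_⟩
  rw [trace_add, trace_smul, trace_smul, hA1, hB1, ← add_smul, hab, one_smul]

theorem sum_eigenvalues_eq_one {A : Matrix (Fin d) (Fin d) ℂ} (hA : A.IsHermitian)
    (h1 : A.trace = 1) : ∑ i, hA.eigenvalues i = 1 := by
  have := hA.trace_eq_sum_eigenvalues.symm.trans h1
  simpa using congrArg Complex.re this

theorem spectrum_subset_Icc_of_mem_stateSpace {A : Matrix (Fin d) (Fin d) ℂ}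
    (hA : A ∈ stateSpace d) : spectrum ℝ A ⊆ Set.Icc 0 1 := by
  rw [hA.1.1.spectrum_real_eq_range_eigenvalues]
  rintro _ ⟨i, rfl⟩
  refine ⟨hA.1.eigenvalues_nonneg i, ?_⟩
  rw [← sum_eigenvalues_eq_one hA.1.1 hA.2]
  exact Finset.single_le_sum (fun i _ => hA.1.eigenvalues_nonneg i) (Finset.mem_univ i)

-- The operator norm provides the C*-algebra structure, in which functional calculus is continuous
-- on self-adjoint elements with spectrum in a fixed compact set.
open scoped Matrix.Norms.L2Operator in
theorem continuousOn_cfc_stateSpace {f : ℝ → ℝ} (hf : Continuous f) :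
    ContinuousOn (fun A : Matrix (Fin d) (Fin d) ℂ => cfc f A) (stateSpace d) :=
  (continuousOn_cfc (Matrix (Fin d) (Fin d) ℂ) (p := IsSelfAdjoint) (isCompact_Icc (a := (0 : ℝ))
    (b := 1)) f hf.continuousOn).mono fun _ hA =>
      ⟨hA.1.1, spectrum_subset_Icc_of_mem_stateSpace hA⟩

theorem cfc_mul_matrix (f g : ℝ → ℝ) (A : Matrix (Fin d) (Fin d) ℂ) :
    cfc (fun x => f x * g x) A = cfc f A * cfc g A :=
  cfc_mul f g A (A.finite_real_spectrum.continuousOn f) (A.finite_real_spectrum.continuousOn g)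

theorem cfc_conjTranspose (f : ℝ → ℝ) (A : Matrix (Fin d) (Fin d) ℂ) : (cfc f A)ᴴ = cfc f A :=
  (cfc_predicate (p := IsSelfAdjoint) f A).star_eq

theorem cfc_sqrt_mul_self {A : Matrix (Fin d) (Fin d) ℂ} (hA : A.PosSemidef) :
    cfc Real.sqrt A * cfc Real.sqrt A = A := by
  rw [← cfc_mul_matrix]
  conv_rhs => rw [← cfc_id ℝ A hA.1.isSelfAdjoint]
  refine cfc_congr fun x hx => ?_
  rw [hA.1.spectrum_real_eq_range_eigenvalues] at hx
  obtain ⟨i, rfl⟩ := hx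
  exact Real.mul_self_sqrt (hA.eigenvalues_nonneg i)

/-- A positive semi-definite matrix dominated by `2 • A` is of the form `√A * M * √A` with
`0 ≤ M ≤ 2`. -/
theorem Matrix.PosSemidef.exists_eq_sqrt_mul_mul_sqrt {A B : Matrix (Fin d) (Fin d) ℂ}
    (hA : A.PosSemidef) (hB : B.PosSemidef) (hBA : ((2 : ℝ) • A - B).PosSemidef) :
    ∃ M : Matrix (Fin d) (Fin d) ℂ, M.PosSemidef ∧ ((2 : ℝ) • 1 - M).PosSemidef ∧
      cfc Real.sqrt A * M * cfc Real.sqrt A = B := by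
  set S := cfc Real.sqrt A with hS
  -- Since `0⁻¹ = 0`, this is the pseudo-inverse of `√A`, and `P` is the projection onto the range
  -- of `A`.
  set R := cfc (fun x => (Real.sqrt x)⁻¹) A with hR
  set P := S * R with hP
  have hSS : S * S = A := cfc_sqrt_mul_self hA
  have hRS : R * S = P := by
    rw [hP, hR, hS, ← cfc_mul_matrix, ← cfc_mul_matrix]
    simp_rw [mul_comm]
  have hSH : Sᴴ = S := cfc_conjTranspose _ _
  have hRH : Rᴴ = R := cfc_conjTranspose _ _
  have hPH : Pᴴ = P := by rw [hP, conjTranspose_mul, hSH, hRH, hRS]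
  have hPS : P * S = S := by
    rw [hP, hS, hR, ← cfc_mul_matrix, ← cfc_mul_matrix]
    exact cfc_congr fun x _ => mul_inv_mul_cancel _
  have hSP : S * P = S := by
    have := congrArg Matrix.conjTranspose hPS
    rwa [conjTranspose_mul, hPH, hSH] at this
  have hPP : P * P = P := by
    rw [hP, ← mul_assoc]
    change P * S * R = S * R
    rw [hPS]
  have hAQ : A * (1 - P) = 0 := by
    rw [← hSS, mul_assoc, mul_sub, hSP, mul_one, sub_self, mul_zero]
  have hQH : (1 - P)ᴴ = 1 - P := by simp [hPH]
  -- Compressed to the kernel of `A`, both `B` and `-B` are positive semi-definite.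
  have hQBQ : (1 - P)ᴴ * B * (1 - P) = 0 := by
    have h1 := hB.conjTranspose_mul_mul_same (1 - P)
    have h2 := hBA.conjTranspose_mul_mul_same (1 - P)
    have h3 : (1 - P)ᴴ * ((2 : ℝ) • A - B) * (1 - P) = -((1 - P)ᴴ * B * (1 - P)) := by
      rw [mul_sub (1 - P)ᴴ, sub_mul _ _ (1 - P), mul_smul_comm, smul_mul_assoc, mul_assoc _ A, hAQ]
      simp
    rw [h3] at h2
    refine h1.trace_eq_zero_iff.1 (le_antisymm ?_ h1.trace_nonneg)
    have := h2.trace_nonneg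
    rwa [trace_neg, neg_nonneg] at this
  have hBQ : B * (1 - P) = 0 := by
    obtain ⟨C, rfl⟩ := hB.exists_eq_conjTranspose_mul_self
    have : C * (1 - P) = 0 := by
      rw [← conjTranspose_mul_self_eq_zero, conjTranspose_mul]
      simpa only [mul_assoc] using hQBQ
    rw [mul_assoc, this, mul_zero]
  have hBP : B * P = B := by
    rw [mul_sub, mul_one, sub_eq_zero] at hBQ
    exact hBQ.symm
  have hPB : P * B = B := by
    have := congrArg Matrix.conjTranspose hBP
    rwa [conjTranspose_mul, hPH, hB.1.eq] at this
  refine ⟨R * B * R, ?_, ?_, ?_⟩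
  · simpa only [hRH] using hB.conjTranspose_mul_mul_same R
  · have h1 := hBA.conjTranspose_mul_mul_same R
    -- `2 - M` splits as `2(1 - P)` plus the compression `R(2A - B)R`.
    have h2 := (posSemidef_conjTranspose_mul_self (1 - P)).smul (zero_le_two (α := ℝ))
    convert h2.add h1 using 1
    have h3 : R * A * R = P := by
      rw [← hSS, ← mul_assoc, hRS, mul_assoc, ← hP, hPP]
    have h4 : (1 - P) * (1 - P) = 1 - P := by
      rw [mul_sub, mul_one, sub_mul, one_mul, hPP, sub_self, sub_zero]
    rw [hQH, h4, hRH, mul_sub, sub_mul, mul_smul_comm, smul_mul_assoc, h3, smul_sub]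
    abel
  · calc S * (R * B * R) * S = P * B * (R * S) := by rw [hP]; simp only [mul_assoc]
      _ = B := by rw [hRS, hPB, hBP]

/-- Rescales a decomposition of `2 • A` into `N` and `2 • A - N` to one with equal traces. -/
def balance (A N : Matrix (Fin d) (Fin d) ℂ) : Matrix (Fin d) (Fin d) ℂ :=
  (max N.trace.re 1)⁻¹ • ((2 : ℝ) • A - (max (2 - N.trace.re) 1)⁻¹ • ((2 : ℝ) • A - N))

theorem balance_of_trace_eq_one {A N : Matrix (Fin d) (Fin d) ℂ} (h : N.trace = 1) :
    balance A N = N := by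
  norm_num [balance, h]

theorem balance_mem {A N : Matrix (Fin d) (Fin d) ℂ} (hA : A ∈ stateSpace d) (hN : N.PosSemidef)
    (hAN : ((2 : ℝ) • A - N).PosSemidef) :
    balance A N ∈ stateSpace d ∧ (2 : ℝ) • A - balance A N ∈ stateSpace d := by
  have htr : N.trace = (N.trace.re : ℂ) := by
    have := (Complex.nonneg_iff.1 hN.trace_nonneg).2
    exact Complex.ext rfl (by simpa using this.symm)
  have htrb : (balance A N).trace = 1 := by
    rw [balance, trace_smul, trace_sub, trace_smul, trace_smul, trace_sub, trace_smul, hA.2, htr]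
    set T := N.trace.re
    simp only [Complex.ofReal_re, Complex.real_smul]
    -- Only one of the two rescalings is active: for trace at most one the complement `2A - N` is
    -- shrunk, otherwise `N` is.
    rcases le_total T 1 with h | h
    · rw [max_eq_right h, max_eq_left (by linarith)]
      have : (2 : ℂ) - T ≠ 0 := by
        have : (2 : ℝ) - T ≠ 0 := by linarith
        exact_mod_cast this
      push_cast
      field_simp
      ring
    · rw [max_eq_left h, max_eq_right (by linarith)]
      have : (T : ℂ) ≠ 0 := by
        have : T ≠ 0 := by linarith
        exact_mod_cast this
      push_cast
      field_simp
      ring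
  have hm : (max N.trace.re 1)⁻¹ ≤ 1 := inv_le_one_of_one_le₀ (le_max_right _ _)
  have hm' : (max (2 - N.trace.re) 1)⁻¹ ≤ 1 := inv_le_one_of_one_le₀ (le_max_right _ _)
  have hm0 : 0 ≤ (max N.trace.re 1)⁻¹ := inv_nonneg.2 (zero_le_one.trans (le_max_right _ _))
  have hm0' : 0 ≤ (max (2 - N.trace.re) 1)⁻¹ :=
    inv_nonneg.2 (zero_le_one.trans (le_max_right _ _))
  refine ⟨⟨?_, htrb⟩, ?_, ?_⟩
  · rw [balance]
    set a := (max N.trace.re 1)⁻¹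
    set b := (max (2 - N.trace.re) 1)⁻¹
    convert ((hA.1.smul (α := ℝ) (show 0 ≤ 2 - 2 * b by linarith)).add (hN.smul hm0')).smul hm0
      using 2
    module
  · rw [balance]
    set a := (max N.trace.re 1)⁻¹
    set b := (max (2 - N.trace.re) 1)⁻¹
    convert (hA.1.smul (α := ℝ) (show 0 ≤ 2 - 2 * a by linarith)).add
      (hAN.smul (mul_nonneg hm0 hm0')) using 1
    module
  · rw [trace_sub, trace_smul, hA.2, htrb]
    norm_num

theorem continuousOn_balance {s : Set (Matrix (Fin d) (Fin d) ℂ)}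
    {N : Matrix (Fin d) (Fin d) ℂ → Matrix (Fin d) (Fin d) ℂ} (hN : ContinuousOn N s) :
    ContinuousOn (fun A => balance A (N A)) s := by
  have htr : ContinuousOn (fun A => (N A).trace.re) s :=
    Complex.continuous_re.comp_continuousOn
      ((continuous_id.matrix_trace).comp_continuousOn hN)
  have h1 : ContinuousOn (fun A => (max (N A).trace.re 1)⁻¹) s :=
    (htr.sup continuousOn_const).inv₀ fun A _ => (zero_lt_one.trans_le (le_max_right _ _)).ne'
  have h2 : ContinuousOn (fun A => (max (2 - (N A).trace.re) 1)⁻¹) s :=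
    ((continuousOn_const.sub htr).sup continuousOn_const).inv₀
      fun A _ => (zero_lt_one.trans_le (le_max_right _ _)).ne'
  exact h1.smul ((continuousOn_id.const_smul (2 : ℝ)).sub
    (h2.smul ((continuousOn_id.const_smul (2 : ℝ)).sub hN)))

theorem midpoint_smul_sub (A B : Matrix (Fin d) (Fin d) ℂ) :
    midpoint ℝ B ((2 : ℝ) • A - B) = A := by
  rw [midpoint_eq_smul_add, add_sub_cancel, smul_smul, invOf_eq_inv]
  norm_num

theorem isStable_stateSpace : IsStable (convex_stateSpace (d := d)) := by
  refine IsOpenMap.of_sections ?_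
  rintro ⟨⟨B, hB⟩, ⟨C, hC⟩⟩
  have hmid : (2 : ℝ) • midpoint ℝ B C - B = C := by
    rw [midpoint_eq_smul_add, smul_smul, invOf_eq_inv]
    norm_num
  set A := midpoint ℝ B C with hAdef
  have hA : A ∈ stateSpace d := convex_stateSpace.midpoint_mem hB hC
  obtain ⟨M, hM, hM2, hMB⟩ := hA.1.exists_eq_sqrt_mul_mul_sqrt hB.1 (by rw [hmid]; exact hC.1)
  -- `M` is kept fixed while the mid-point varies. This choice gives `0 ≤ N X ≤ 2X` and `N A = B`;
  -- only the trace needs correcting, by `balance`.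
  let N : Matrix (Fin d) (Fin d) ℂ → Matrix (Fin d) (Fin d) ℂ :=
    fun X => cfc Real.sqrt X * M * cfc Real.sqrt X
  have hNc : ContinuousOn N (stateSpace d) := by
    have := continuousOn_cfc_stateSpace (d := d) Real.continuous_sqrt
    exact (this.mul continuousOn_const).mul this
  have hbc := continuousOn_balance hNc
  have hmem : ∀ X ∈ stateSpace d, balance X (N X) ∈ stateSpace d ∧
      (2 : ℝ) • X - balance X (N X) ∈ stateSpace d := by
    intro X hX
    refine balance_mem hX ?_ ?_
    · simpa only [cfc_conjTranspose] using hM.conjTranspose_mul_mul_same (cfc Real.sqrt X)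
    · have := hM2.conjTranspose_mul_mul_same (cfc Real.sqrt X)
      rw [cfc_conjTranspose, mul_sub, sub_mul, mul_smul_comm, smul_mul_assoc, mul_one,
        cfc_sqrt_mul_self hX.1] at this
      exact this
  have hbA : balance A (N A) = B := by
    have : N A = B := hMB
    rw [this, balance_of_trace_eq_one hB.2]
  refine ⟨fun X => (⟨_, (hmem X X.2).1⟩, ⟨_, (hmem X X.2).2⟩), ?_, ?_, ?_⟩
  · refine Continuous.continuousAt ?_
    have hc : Continuous fun X : stateSpace d => balance (X : Matrix (Fin d) (Fin d) ℂ) (N X) :=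
      continuousOn_iff_continuous_domRestrict.1 hbc
    exact (hc.subtype_mk _).prodMk
      (((continuous_subtype_val.const_smul (2 : ℝ)).sub hc).subtype_mk _)
  · refine Prod.ext (Subtype.ext hbA) (Subtype.ext ?_)
    change (2 : ℝ) • A - balance A (N A) = C
    rw [hbA, hmid]
  · intro X
    exact Subtype.ext (midpoint_smul_sub _ _)

end StateSpace

/-! ### Entropy maximizers are relative interior points -/

section Entropy

variable {d : ℕ}

/-- The diagonal entries of `A` in the orthonormal basis formed by the columns of `V`. -/
def diagIn (V A : Matrix (Fin d) (Fin d) ℂ) (i : Fin d) : ℝ :=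
  ((Vᴴ * A * V) i i).re

theorem diagIn_add_smul (V A B : Matrix (Fin d) (Fin d) ℂ) (a b : ℝ) (i : Fin d) :
    diagIn V (a • A + b • B) i = a * diagIn V A i + b * diagIn V B i := by
  simp [diagIn, mul_add, add_mul]

theorem diagIn_nonneg (V : Matrix (Fin d) (Fin d) ℂ) {A : Matrix (Fin d) (Fin d) ℂ}
    (hA : A.PosSemidef) (i : Fin d) : 0 ≤ diagIn V A i :=
  (Complex.nonneg_iff.1 (hA.conjTranspose_mul_mul_same V).diag_nonneg).1

theorem sum_diagIn {V : Matrix (Fin d) (Fin d) ℂ} (hV : V * Vᴴ = 1) {A : Matrix (Fin d) (Fin d) ℂ}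
    (h1 : A.trace = 1) : ∑ i, diagIn V A i = 1 := by
  have : (Vᴴ * A * V).trace = 1 := by
    rw [trace_mul_cycle, hV, one_mul, h1]
  simpa [trace, diagIn] using congrArg Complex.re this

/-- For unitary `W` the weights `‖W j i‖ ^ 2` form a doubly stochastic matrix. -/
theorem diagIn_conj_diagonal (W : Matrix (Fin d) (Fin d) ℂ) (μ : Fin d → ℝ) (i : Fin d) :
    diagIn W (diagonal fun j => (μ j : ℂ)) i = ∑ j, ‖W j i‖ ^ 2 * μ j := by
  rw [diagIn, mul_apply, Complex.re_sum]
  simp only [mul_diagonal, conjTranspose_apply]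
  refine Finset.sum_congr rfl fun j _ => ?_
  rw [mul_right_comm, Complex.star_def, mul_comm ((starRingEnd ℂ) _), Complex.mul_conj,
    Complex.normSq_eq_norm_sq]
  norm_cast

theorem sum_norm_sq_col {W : Matrix (Fin d) (Fin d) ℂ} (hW : Wᴴ * W = 1) (i : Fin d) :
    ∑ j, ‖W j i‖ ^ 2 = 1 := by
  have h := diagIn_conj_diagonal W (fun _ => 1) i
  simp only [mul_one, Complex.ofReal_one] at h
  rw [← h, diagIn, diagonal_one, mul_one, hW]
  simp

theorem sum_norm_sq_row {W : Matrix (Fin d) (Fin d) ℂ} (hW : W * Wᴴ = 1) (j : Fin d) :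
    ∑ i, ‖W j i‖ ^ 2 = 1 := by
  simpa using sum_norm_sq_col (W := Wᴴ) (by simpa using hW) j

theorem Matrix.IsHermitian.exists_unitary_diagonal {A : Matrix (Fin d) (Fin d) ℂ}
    (hA : A.IsHermitian) : ∃ U : Matrix (Fin d) (Fin d) ℂ, Uᴴ * U = 1 ∧ U * Uᴴ = 1 ∧
      A = U * (diagonal fun i => (hA.eigenvalues i : ℂ)) * Uᴴ ∧
      ∀ f : ℝ → ℝ, cfc f A = U * (diagonal fun i => (f (hA.eigenvalues i) : ℂ)) * Uᴴ := by
  refine ⟨hA.eigenvectorUnitary, Unitary.coe_star_mul_self _, Unitary.coe_mul_star_self _, ?_, ?_⟩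
  · conv_lhs => rw [hA.spectral_theorem, Unitary.conjStarAlgAut_apply]
    rfl
  · intro f
    rw [hA.cfc_eq, IsHermitian.cfc, Unitary.conjStarAlgAut_apply]
    rfl

theorem vonNeumannEntropy_eq {A : Matrix (Fin d) (Fin d) ℂ} (hA : A.IsHermitian) :
    vonNeumannEntropy A = -∑ i, hA.eigenvalues i * Real.log (hA.eigenvalues i) := by
  obtain ⟨U, hU, -, -, hf⟩ := hA.exists_unitary_diagonal
  rw [vonNeumannEntropy, hf, trace_mul_cycle, hU, one_mul, trace_diagonal, Complex.re_sum]
  simp only [Complex.ofReal_re]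

/-- Peierls' inequality: the trace of a convex function of a positive semi-definite matrix bounds
the sum of the values of the function on the diagonal, in any orthonormal basis. -/
theorem sum_diagIn_le_sum_eigenvalues {f : ℝ → ℝ} (hf : ConvexOn ℝ (Set.Ici 0) f)
    {A V : Matrix (Fin d) (Fin d) ℂ} (hA : A.PosSemidef) (hV : Vᴴ * V = 1) (hV' : V * Vᴴ = 1) :
    ∑ i, f (diagIn V A i) ≤ ∑ j, f (hA.1.eigenvalues j) := by
  obtain ⟨U, hU, hU', hA', -⟩ := hA.1.exists_unitary_diagonal
  set μ := hA.1.eigenvalues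
  have hW : (Uᴴ * V)ᴴ * (Uᴴ * V) = 1 := by
    rw [conjTranspose_mul, conjTranspose_conjTranspose, mul_assoc, ← mul_assoc U, hU', one_mul, hV]
  have hW' : (Uᴴ * V) * (Uᴴ * V)ᴴ = 1 := by
    rw [conjTranspose_mul, conjTranspose_conjTranspose, mul_assoc, ← mul_assoc V, hV', one_mul, hU]
  have hp : ∀ i, diagIn V A i = ∑ j, ‖(Uᴴ * V) j i‖ ^ 2 * μ j := by
    intro i
    rw [← diagIn_conj_diagonal, diagIn, diagIn, hA', conjTranspose_mul,
      conjTranspose_conjTranspose]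
    simp only [mul_assoc]
  -- Column sums equal to one permit Jensen's inequality; row sums equal to one collapse the result.
  calc ∑ i, f (diagIn V A i) ≤ ∑ i, ∑ j, ‖(Uᴴ * V) j i‖ ^ 2 * f (μ j) := by
        refine Finset.sum_le_sum fun i _ => ?_
        rw [hp]
        exact hf.map_sum_le (fun j _ => by positivity) (sum_norm_sq_col hW i)
          fun j _ => hA.eigenvalues_nonneg j
    _ = ∑ j, (∑ i, ‖(Uᴴ * V) j i‖ ^ 2) * f (μ j) := by
        rw [Finset.sum_comm]
        simp only [Finset.sum_mul]
    _ = ∑ j, f (μ j) := by simp only [sum_norm_sq_row hW', one_mul]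

/-- A positive semi-definite matrix is dominated by a multiple of its diagonal. -/
theorem Matrix.PosSemidef.card_smul_diagonal_sub {A : Matrix (Fin d) (Fin d) ℂ}
    (hA : A.PosSemidef) :
    ((diagonal fun i => ((d * (A i i).re : ℝ) : ℂ)) - A).PosSemidef := by
  have hD : (diagonal fun i => ((d * (A i i).re : ℝ) : ℂ)).IsHermitian := by
    refine isHermitian_diagonal_of_self_adjoint _ ?_
    ext i
    simp
  refine PosSemidef.of_dotProduct_mulVec_nonneg (hD.sub hA.1) fun x => ?_
  -- The factorization turns both quadratic forms into sums over the rows of `B`, to be compared by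
  -- Cauchy–Schwarz.
  obtain ⟨B, rfl⟩ := hA.exists_eq_conjTranspose_mul_self
  have hdiag : ∀ i, ((Bᴴ * B) i i).re = ∑ k, ‖B k i‖ ^ 2 := by
    intro i
    have := diagIn_conj_diagonal B (fun _ => 1) i
    simpa [diagIn] using this
  have h1 : star x ⬝ᵥ (diagonal fun i => ((d * ((Bᴴ * B) i i).re : ℝ) : ℂ)) *ᵥ x =
      ((∑ k, d * ∑ i, ‖B k i * x i‖ ^ 2 : ℝ) : ℂ) := by
    simp only [dotProduct, mulVec_diagonal, Pi.star_apply, hdiag]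
    rw [← Finset.mul_sum, Finset.sum_comm, Finset.mul_sum, Complex.ofReal_sum]
    refine Finset.sum_congr rfl fun i _ => ?_
    rw [mul_left_comm, Complex.star_def, mul_comm ((starRingEnd ℂ) _), Complex.mul_conj,
      Complex.normSq_eq_norm_sq, ← Complex.ofReal_mul]
    simp only [norm_mul, mul_pow, ← Finset.sum_mul, mul_assoc]
  have h2 : star x ⬝ᵥ (Bᴴ * B) *ᵥ x = ((∑ k, ‖∑ i, B k i * x i‖ ^ 2 : ℝ) : ℂ) := by
    rw [← mulVec_mulVec, dotProduct_mulVec, vecMul_conjTranspose, star_star, dotProduct,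
      Complex.ofReal_sum]
    refine Finset.sum_congr rfl fun k _ => ?_
    rw [Pi.star_apply, Complex.star_def, mul_comm, Complex.mul_conj, Complex.normSq_eq_norm_sq]
    rfl
  rw [sub_mulVec, dotProduct_sub, h1, h2, sub_nonneg, Complex.real_le_real]
  refine Finset.sum_le_sum fun k _ => ?_
  calc ‖∑ i, B k i * x i‖ ^ 2 ≤ (∑ i, ‖B k i * x i‖) ^ 2 := by
        gcongr
        exact norm_sum_le _ _
    _ ≤ d * ∑ i, ‖B k i * x i‖ ^ 2 := by
        simpa using sq_sum_le_card_mul_sum_sq (s := Finset.univ) (f := fun i => ‖B k i * x i‖)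

theorem diagIn_le_card_mul_sum (W : Matrix (Fin d) (Fin d) ℂ) {A : Matrix (Fin d) (Fin d) ℂ}
    (hA : A.PosSemidef) (k : Fin d) :
    diagIn W A k ≤ d * ∑ i, ‖W i k‖ ^ 2 * (A i i).re := by
  have h := diagIn_nonneg W hA.card_smul_diagonal_sub k
  rw [show (diagonal fun i => ((d * (A i i).re : ℝ) : ℂ)) - A =
    (1 : ℝ) • (diagonal fun i => ((d * (A i i).re : ℝ) : ℂ)) + (-1 : ℝ) • A by module,
    diagIn_add_smul, diagIn_conj_diagonal] at h
  rw [Finset.mul_sum]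
  simp only [mul_left_comm] at h ⊢
  linarith

/-- Gibbs' inequality. -/
theorem mul_log_add_sub_le {p l : ℝ} (hp : 0 ≤ p) (hl : 0 ≤ l) (h : l = 0 → p = 0) :
    p * Real.log l + p - l ≤ p * Real.log p := by
  rcases hl.eq_or_lt with rfl | hl
  · simp [h rfl]
  rcases hp.eq_or_lt with rfl | hp
  · simp [hl.le]
  have := Real.log_le_sub_one_of_pos (div_pos hl hp)
  rw [Real.log_div hl.ne' hp.ne'] at this
  have h2 := mul_le_mul_of_nonneg_left this hp.le
  rw [mul_sub, mul_sub, mul_div_cancel₀ _ hp.ne'] at h2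
  linarith

/-- If mixing `ρ` with a small amount `t` of `σ` does not increase the entropy, then in an
eigenbasis of the mixture the mass which `σ` puts on small eigenvalues is controlled. Here `p` and
`q` are the diagonals of `ρ` and `σ` in that basis. -/
theorem sum_mul_neg_log_le {p q : Fin d → ℝ} {t : ℝ} (ht : 0 < t) (ht' : t ≤ 1 / 2)
    (hp : ∀ i, 0 ≤ p i) (hq : ∀ i, 0 ≤ q i) (hp1 : ∑ i, p i = 1) (hq1 : ∑ i, q i = 1)
    (h : ∑ i, p i * Real.log (p i) ≤
      ∑ i, ((1 - t) * p i + t * q i) * Real.log ((1 - t) * p i + t * q i)) :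
    ∑ i, q i * -Real.log ((1 - t) * p i + t * q i) ≤ 2 * d := by
  set l : Fin d → ℝ := fun i => (1 - t) * p i + t * q i with hl
  have hl0 : ∀ i, 0 ≤ l i := fun i =>
    add_nonneg (mul_nonneg (by linarith) (hp i)) (mul_nonneg ht.le (hq i))
  have hl1 : ∑ i, l i = 1 := by
    simp only [hl, Finset.sum_add_distrib, ← Finset.mul_sum, hp1, hq1]
    ring
  have hle1 : ∀ i, l i ≤ 1 := fun i => by
    rw [← hl1]
    exact Finset.single_le_sum (fun i _ => hl0 i) (Finset.mem_univ i)
  have hgibbs : ∑ i, p i * Real.log (l i) ≤ ∑ i, p i * Real.log (p i) := by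
    have : ∑ i, (p i * Real.log (l i) + p i - l i) ≤ ∑ i, p i * Real.log (p i) := by
      refine Finset.sum_le_sum fun i _ => mul_log_add_sub_le (hp i) (hl0 i) fun h0 => ?_
      have h1 : (1 - t) * p i + t * q i = 0 := h0
      nlinarith [hp i, mul_nonneg ht.le (hq i)]
    rw [Finset.sum_sub_distrib, Finset.sum_add_distrib, hp1, hl1] at this
    linarith
  have hdiff : ∑ i, q i * -Real.log (l i) ≤ ∑ i, p i * -Real.log (l i) := by
    -- Expanding the weight `l` and applying Gibbs' inequality to the `p` part leaves a comparison
    -- with the common factor `t`.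
    have h1 : ∑ i, l i * Real.log (l i) =
        (1 - t) * ∑ i, p i * Real.log (l i) + t * ∑ i, q i * Real.log (l i) := by
      rw [Finset.mul_sum, Finset.mul_sum, ← Finset.sum_add_distrib]
      refine Finset.sum_congr rfl fun i _ => ?_
      simp only [hl]
      ring
    have h2 : ∑ i, p i * Real.log (l i) ≤ ∑ i, l i * Real.log (l i) := hgibbs.trans h
    rw [h1] at h2
    have h3 : t * ∑ i, p i * Real.log (l i) ≤ t * ∑ i, q i * Real.log (l i) := by linarith
    have h4 := le_of_mul_le_mul_left h3 ht
    simp only [mul_neg, Finset.sum_neg_distrib]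
    linarith
  refine hdiff.trans ?_
  -- Here `p ≤ 2l` because `t ≤ 1/2`, and `-l log l ≤ 1 - l ≤ 1`.
  calc ∑ i, p i * -Real.log (l i) ≤ ∑ _i : Fin d, (2 : ℝ) := by
        refine Finset.sum_le_sum fun i _ => ?_
        have h1 : p i ≤ 2 * l i := by
          have : l i = (1 - t) * p i + t * q i := rfl
          nlinarith [hp i, mul_nonneg ht.le (hq i)]
        have h2 : 0 ≤ -Real.log (l i) := neg_nonneg.2 (Real.log_nonpos (hl0 i) (hle1 i))
        have h3 := Real.self_sub_one_le_mul_log (hl0 i)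
        nlinarith [mul_le_mul_of_nonneg_right h1 h2, hl0 i]
    _ = 2 * d := by simp [mul_comm]

/-- If moving from `A` towards `B` never increases the entropy, then `B` vanishes on the kernel
of `A`. -/
theorem diagIn_eq_zero_of_entropy_le {A B U : Matrix (Fin d) (Fin d) ℂ} (hA : A ∈ stateSpace d)
    (hB : B ∈ stateSpace d) (hU : Uᴴ * U = 1) {k : Fin d}
    (hk : diagIn U A k = 0)
    (hmax : ∀ t : ℝ, 0 < t → t ≤ 1 / 2 →
      vonNeumannEntropy ((1 - t) • A + t • B) ≤ vonNeumannEntropy A) :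
    diagIn U B k = 0 := by
  by_contra hne
  set a := diagIn U B k with ha
  have ha0 : 0 < a := lt_of_le_of_ne (diagIn_nonneg U hB.1 k) (Ne.symm hne)
  have hd : (1 : ℝ) ≤ d := by exact_mod_cast k.pos
  -- `n` and `t` are chosen so that some eigenvalue `l i ≤ t d² ≤ exp (-n)` of the mixture carries
  -- `B`-mass at least `a / d²`. This contributes at least `n a / d² > 2d` to the sum bounded by
  -- `sum_mul_neg_log_le`.
  obtain ⟨n, hn⟩ := exists_nat_gt (2 * d / (a / d ^ 2))
  have hn' : 2 * d < (n : ℝ) * (a / d ^ 2) := (div_lt_iff₀ (by positivity)).1 hn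
  set t : ℝ := Real.exp (-n) / (2 * d ^ 2) with ht
  have ht0 : 0 < t := by positivity
  have hexp : Real.exp (-n) ≤ 1 := Real.exp_le_one_iff.2 (by simp)
  have ht1 : t ≤ 1 / 2 := by
    rw [ht, div_le_div_iff₀ (by positivity) (by norm_num)]
    nlinarith
  have htd : t * d ^ 2 ≤ Real.exp (-n) := by
    rw [ht, div_mul_eq_mul_div, div_le_iff₀ (by positivity)]
    nlinarith [Real.exp_pos (-n), sq_nonneg (d : ℝ)]
  have hT : (1 - t) • A + t • B ∈ stateSpace d :=
    convex_stateSpace hA hB (by linarith) ht0.le (by ring)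
  have hle := hmax t ht0 ht1
  rw [vonNeumannEntropy_eq hA.1.1, vonNeumannEntropy_eq hT.1.1, neg_le_neg_iff] at hle
  obtain ⟨V, hV, hV', hTV, -⟩ := hT.1.1.exists_unitary_diagonal
  set l := hT.1.1.eigenvalues with hl
  have hVTV : Vᴴ * ((1 - t) • A + t • B) * V = diagonal fun i => (l i : ℂ) := by
    rw [hTV]
    calc Vᴴ * (V * (diagonal fun i => (l i : ℂ)) * Vᴴ) * V =
        (Vᴴ * V) * (diagonal fun i => (l i : ℂ)) * (Vᴴ * V) := by simp only [mul_assoc]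
      _ = _ := by rw [hV, one_mul, mul_one]
  set p := diagIn V A with hp
  set q := diagIn V B with hq
  have hlpq : ∀ i, l i = (1 - t) * p i + t * q i := by
    intro i
    rw [hp, hq, ← diagIn_add_smul, diagIn, hVTV]
    simp
  -- Peierls' inequality for `A`, in the eigenbasis of the mixture.
  have hpeierls := (sum_diagIn_le_sum_eigenvalues Real.convexOn_mul_log hA.1 hV hV').trans hle
  have hp0 : ∀ i, 0 ≤ p i := diagIn_nonneg V hA.1
  have hq0 : ∀ i, 0 ≤ q i := diagIn_nonneg V hB.1
  have hq1 : ∑ i, q i = 1 := sum_diagIn hV' hB.2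
  have hbound := sum_mul_neg_log_le ht0 ht1 hp0 hq0 (sum_diagIn hV' hA.2) hq1
    (by simpa only [hlpq] using hpeierls)
  -- Column `k` of `W` is the kernel vector of `A` written in the eigenbasis of the mixture.
  set W := Vᴴ * U with hW
  have hWW : Wᴴ * W = 1 := by
    rw [hW, conjTranspose_mul, conjTranspose_conjTranspose, mul_assoc, ← mul_assoc V, hV', one_mul,
      hU]
  have hc1 : ∀ i, ‖W i k‖ ^ 2 ≤ 1 := fun i => by
    rw [← sum_norm_sq_col hWW k]
    exact Finset.single_le_sum (f := fun i => ‖W i k‖ ^ 2) (fun i _ => by positivity)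
      (Finset.mem_univ i)
  have hconj : ∀ X, diagIn W (Vᴴ * X * V) k = diagIn U X k := by
    intro X
    have : Wᴴ * (Vᴴ * X * V) * W = (Uᴴ * (V * Vᴴ)) * X * ((V * Vᴴ) * U) := by
      rw [hW, conjTranspose_mul, conjTranspose_conjTranspose]
      simp only [mul_assoc]
    rw [diagIn, this, hV', mul_one, one_mul, diagIn]
  have hsum : a ≤ d * ∑ i, ‖W i k‖ ^ 2 * q i := by
    have := diagIn_le_card_mul_sum W (hB.1.conjTranspose_mul_mul_same V) k
    rwa [hconj] at this
  have hsuml : ∑ i, ‖W i k‖ ^ 2 * l i = t * a := by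
    rw [← diagIn_conj_diagonal, ← hVTV, hconj, diagIn_add_smul, hk, ha]
    ring
  have hl0 : ∀ i, 0 ≤ l i := fun i => hT.1.eigenvalues_nonneg i
  -- Pigeonhole on `hsum`. As both factors are at most one, each is at least `a / d²`.
  obtain ⟨i, hi⟩ : ∃ i, a / d ^ 2 ≤ ‖W i k‖ ^ 2 * q i := by
    by_contra! hlt
    have : ∑ i, ‖W i k‖ ^ 2 * q i < ∑ _i : Fin d, a / d ^ 2 :=
      Finset.sum_lt_sum_of_nonempty ⟨k, Finset.mem_univ k⟩ fun i _ => hlt i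
    rw [Finset.sum_const, Finset.card_univ, Fintype.card_fin, nsmul_eq_mul] at this
    have h2 : (d : ℝ) * (d * (a / d ^ 2)) = a := by field_simp
    nlinarith
  have hqi1 : q i ≤ 1 := by
    rw [← hq1]
    exact Finset.single_le_sum (fun i _ => hq0 i) (Finset.mem_univ i)
  have hqi : a / d ^ 2 ≤ q i := hi.trans (mul_le_of_le_one_left (hq0 i) (hc1 i))
  have hci : a / d ^ 2 ≤ ‖W i k‖ ^ 2 := hi.trans (mul_le_of_le_one_right (by positivity) hqi1)
  have hli : l i ≤ Real.exp (-n) := by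
    refine le_trans ?_ htd
    have h1 : ‖W i k‖ ^ 2 * l i ≤ t * a := by
      rw [← hsuml]
      exact Finset.single_le_sum (f := fun i => ‖W i k‖ ^ 2 * l i)
        (fun i _ => mul_nonneg (by positivity) (hl0 i)) (Finset.mem_univ i)
    have h2 : a / d ^ 2 * l i ≤ t * a := (mul_le_mul_of_nonneg_right hci (hl0 i)).trans h1
    rw [div_mul_eq_mul_div, div_le_iff₀ (by positivity)] at h2
    exact le_of_mul_le_mul_left (by linarith) ha0
  have hli0 : 0 < l i := by
    rw [hlpq]
    have : 0 < q i := lt_of_lt_of_le (by positivity) hqi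
    have : 0 ≤ (1 - t) * p i := mul_nonneg (by linarith) (hp0 i)
    positivity
  have hlog : (n : ℝ) ≤ -Real.log (l i) := by
    have := Real.log_le_log hli0 hli
    rw [Real.log_exp] at this
    linarith
  have hterm : q i * -Real.log (l i) ≤ 2 * d := by
    refine le_trans ?_ hbound
    simp only [← hlpq]
    refine Finset.single_le_sum (f := fun i => q i * -Real.log (l i)) (fun j _ => ?_)
      (Finset.mem_univ i)
    have := spectrum_subset_Icc_of_mem_stateSpace hT (hT.1.1.eigenvalues_mem_spectrum_real j)
    exact mul_nonneg (hq0 j) (neg_nonneg.2 (Real.log_nonpos this.1 this.2))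
  have : (n : ℝ) * (a / d ^ 2) ≤ q i * -Real.log (l i) := by
    rw [mul_comm]
    exact mul_le_mul hqi hlog (by positivity) (hq0 i)
  linarith

/-- In an eigenbasis of `A`, `B` is at most `d` times its diagonal, which vanishes wherever `A`
does. Hence `B ≤ c A` for some `c`. -/
theorem exists_extension_of_entropy_le {A B : Matrix (Fin d) (Fin d) ℂ} (hA : A ∈ stateSpace d)
    (hB : B ∈ stateSpace d)
    (hmax : ∀ t : ℝ, 0 < t → t ≤ 1 / 2 →
      vonNeumannEntropy ((1 - t) • A + t • B) ≤ vonNeumannEntropy A) :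
    ∃ s : ℝ, 0 < s ∧ (1 + s) • A - s • B ∈ stateSpace d := by
  obtain ⟨U, hU, hU', hAU, -⟩ := hA.1.1.exists_unitary_diagonal
  set μ := hA.1.1.eigenvalues with hμ
  have hμ0 : ∀ i, 0 ≤ μ i := hA.1.eigenvalues_nonneg
  have hUAU : Uᴴ * A * U = diagonal fun i => (μ i : ℂ) := by
    rw [hAU]
    calc Uᴴ * (U * (diagonal fun i => (μ i : ℂ)) * Uᴴ) * U =
        (Uᴴ * U) * (diagonal fun i => (μ i : ℂ)) * (Uᴴ * U) := by simp only [mul_assoc]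
      _ = _ := by rw [hU, one_mul, mul_one]
  have hq : ∀ i, μ i = 0 → diagIn U B i = 0 := fun i hi =>
    diagIn_eq_zero_of_entropy_le hA hB hU (by simp [diagIn, hUAU, hi]) hmax
  have hq0 := diagIn_nonneg U hB.1
  -- Terms with `μ i = 0` are zero by the division convention, consistently with `hq`.
  set c : ℝ := ∑ i, d * diagIn U B i / μ i with hc
  have hterm : ∀ i, 0 ≤ d * diagIn U B i / μ i := fun i =>
    div_nonneg (mul_nonneg (by positivity) (hq0 i)) (hμ0 i)
  have hc0 : 0 ≤ c := Finset.sum_nonneg fun i _ => hterm i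
  have hci : ∀ i, d * diagIn U B i ≤ c * μ i := by
    intro i
    rcases (hμ0 i).eq_or_lt with h | h
    · simp [← h, hq i h.symm]
    · rw [← div_le_iff₀ h]
      exact Finset.single_le_sum (fun i _ => hterm i) (Finset.mem_univ i)
  -- This `s` satisfies `s c ≤ 1`, so `s B ≤ A ≤ (1 + s) A`.
  refine ⟨1 / (c + 1), by positivity, ?_, ?_⟩
  · set s := 1 / (c + 1) with hs
    have hs0 : 0 < s := by positivity
    have hsc : s * c ≤ 1 := by
      rw [hs, div_mul_eq_mul_div, div_le_one (by positivity)]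
      linarith
    have hdom := ((hB.1.conjTranspose_mul_mul_same U).card_smul_diagonal_sub).smul hs0.le
    have hdiag : (diagonal fun i => (((1 + s) * μ i - s * (d * diagIn U B i) : ℝ) : ℂ)).PosSemidef :=
      PosSemidef.diagonal fun i => by
        have h1 := mul_le_mul_of_nonneg_left (hci i) hs0.le
        have h2 := mul_le_mul_of_nonneg_right hsc (hμ0 i)
        have h3 : 0 ≤ (1 + s) * μ i - s * (d * diagIn U B i) := by
          nlinarith [mul_nonneg hs0.le (hμ0 i)]
        simpa using (Complex.real_le_real.2 h3)
    have hsum := (hdom.add hdiag).mul_mul_conjTranspose_same U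
    convert hsum using 1
    have e : s • ((diagonal fun i => ((d * ((Uᴴ * B * U) i i).re : ℝ) : ℂ)) - Uᴴ * B * U) +
        (diagonal fun i => (((1 + s) * μ i - s * (d * diagIn U B i) : ℝ) : ℂ)) =
        Uᴴ * ((1 + s) • A - s • B) * U := by
      rw [mul_sub, sub_mul, mul_smul_comm, smul_mul_assoc, mul_smul_comm, smul_mul_assoc, hUAU]
      ext i j
      rcases eq_or_ne i j with rfl | hij
      · simp [diagIn]
        ring
      · simp [hij]
    rw [e]
    calc (1 + s) • A - s • B = (U * Uᴴ) * ((1 + s) • A - s • B) * (U * Uᴴ) := by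
          rw [hU', one_mul, mul_one]
      _ = _ := by simp only [mul_assoc]
  · rw [trace_sub, trace_smul, trace_smul, hA.2, hB.2, ← sub_smul]
    simp

end Entropy

/-! ### Discontinuity of the maximum-entropy inference -/

section MaxEnt

variable {d r : ℕ}

/-- The expected value functional as a real linear map. -/
def expectedValueLinear (u : Fin r → Matrix (Fin d) (Fin d) ℂ) :
    Matrix (Fin d) (Fin d) ℂ →ₗ[ℝ] (Fin r → ℝ) where
  toFun := expectedValue u
  map_add' A B := by
    ext i
    simp [expectedValue, mul_add]
  map_smul' c A := by
    ext i
    simp [expectedValue]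

theorem continuous_expectedValue (u : Fin r → Matrix (Fin d) (Fin d) ℂ) :
    Continuous (expectedValue u) := by
  refine continuous_pi fun i => Complex.continuous_re.comp ?_
  fun_prop

/-- A maximizer exists because the entropy is continuous on the compact nonempty fiber; the choice
operator then returns one. -/
theorem maxEntInference_spec (u : Fin r → Matrix (Fin d) (Fin d) ℂ) (α : convexSupport u) :
    maxEntInference u α ∈ fiber (expectedValue u) (stateSpace d) α ∧
      IsMaxOn vonNeumannEntropy (fiber (expectedValue u) (stateSpace d) α)
        (maxEntInference u α) := by
  refine Classical.epsilon_spec (p := fun ρ =>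
    ρ ∈ fiber (expectedValue u) (stateSpace d) (α : Fin r → ℝ) ∧
      IsMaxOn vonNeumannEntropy (fiber (expectedValue u) (stateSpace d) (α : Fin r → ℝ)) ρ) ?_
  have hcompact : IsCompact (fiber (expectedValue u) (stateSpace d) (α : Fin r → ℝ)) :=
    isCompact_stateSpace.inter_right
      (isClosed_eq (continuous_expectedValue u) continuous_const)
  refine hcompact.exists_isMaxOn α.2 ?_
  have h := (continuousOn_cfc_stateSpace (d := d) Real.continuous_mul_log).mono
    (Set.sep_subset (stateSpace d) fun A => expectedValue u A = α)
  exact (Complex.continuous_re.comp_continuousOn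
    ((continuous_id.matrix_trace).comp_continuousOn h)).neg

theorem convex_fiber_stateSpace (u : Fin r → Matrix (Fin d) (Fin d) ℂ) (α : Fin r → ℝ) :
    Convex ℝ (fiber (expectedValue u) (stateSpace d) α) :=
  convex_stateSpace.inter ((convex_singleton α).linear_preimage (expectedValueLinear u))

-- The fiber is convex, so maximality controls every segment from the maximizer to another of its
-- points, and each such segment extends beyond the maximizer. The norm only supplies the normed
-- structure required by the face lemmas.
open scoped Matrix.Norms.Elementwise in
theorem maxEntInference_mem_intrinsicInterior (u : Fin r → Matrix (Fin d) (Fin d) ℂ)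
    (α : convexSupport u) :
    maxEntInference u α ∈ intrinsicInterior ℝ (fiber (expectedValue u) (stateSpace d) α) := by
  obtain ⟨hmem, hmax⟩ := maxEntInference_spec u α
  set ρ := maxEntInference u α
  have hconv := convex_fiber_stateSpace u (α : Fin r → ℝ)
  refine mem_intrinsicInterior_of_extension hconv hmem fun σ hσ => ?_
  obtain ⟨s, hs, hz⟩ := exists_extension_of_entropy_le hmem.1 hσ.1 fun t ht ht' =>
    hmax (hconv hmem hσ (by linarith) ht.le (by ring))
  refine ⟨(1 + s) • ρ - s • σ, ⟨hz, ?_⟩, s / (1 + s), 1 / (1 + s), by positivity, by positivity,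
    by field_simp; ring, ?_⟩
  · have h := (expectedValueLinear u).map_sub ((1 + s) • ρ) (s • σ)
    rw [map_smul, map_smul] at h
    have h1 : expectedValueLinear u ρ = α := hmem.2
    have h2 : expectedValueLinear u σ = α := hσ.2
    rw [h1, h2] at h
    refine h.trans ?_
    module
  · match_scalars <;> field_simp
    ring

theorem faceAt_eq_singleton_of_mem_extremePoints {V : Type*} [NormedAddCommGroup V]
    [NormedSpace ℝ V] [FiniteDimensional ℝ V] {C : Set V} (hC : Convex ℝ C) {x : V}
    (hx : x ∈ C.extremePoints ℝ) : faceAt C x = {x} := by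
  refine faceAt_eq hC hx.1 ⟨convex_singleton x, isExtreme_singleton.2 hx⟩ ?_
  simp

theorem exists_mem_faceAt_ne {V : Type*} [NormedAddCommGroup V]
    [NormedSpace ℝ V] [FiniteDimensional ℝ V] {C : Set V} (hC : Convex ℝ C) {x : V} (hxC : x ∈ C)
    (hx : x ∉ C.extremePoints ℝ) : ∃ y ∈ faceAt C x, y ≠ x := by
  simp only [mem_extremePoints_iff_left, hxC, true_and] at hx
  push Not at hx
  obtain ⟨y, hy, z, hz, hs, hne⟩ := hx
  exact ⟨y, (mem_faceAt_iff hC hxC).2 ⟨hy, z, hz, hs⟩, hne⟩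

open scoped Matrix.Norms.Elementwise in
theorem not_continuousAt_maxEntInference (u : Fin r → Matrix (Fin d) (Fin d) ℂ)
    {α : ℕ → Fin r → ℝ} {α₀ : convexSupport u}
    (hα : ∀ n, α n ∈ (convexSupport u).extremePoints ℝ)
    (hlim : Tendsto α atTop (𝓝 (α₀ : Fin r → ℝ)))
    (hα₀ : (α₀ : Fin r → ℝ) ∉ (convexSupport u).extremePoints ℝ) :
    ¬ ContinuousAt (maxEntInference u) α₀ := by
  intro hcont
  have hL : Convex ℝ (convexSupport u) := convex_stateSpace.linear_image (expectedValueLinear u)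
  obtain ⟨y, hy, hne⟩ := exists_mem_faceAt_ne hL α₀.2 hα₀
  have hlim' : Tendsto (fun n => (⟨α n, (hα n).1⟩ : convexSupport u)) atTop (𝓝 α₀) :=
    tendsto_subtype_rng.2 hlim
  have hspec := fun n => (maxEntInference_spec u ⟨α n, (hα n).1⟩).1
  -- The faces `{α n}` must eventually meet `U` by (A), yet they lie in the disjoint neighbourhood
  -- `U'` of the limit.
  obtain ⟨U, U', hU, hU', hdisj⟩ := t2_separation_nhds hne
  have hev := isStable_stateSpace.eventually_inter_faceAt_image (expectedValueLinear u)
    (fun n => (hspec n).1) (hcont.tendsto.comp hlim') (fun n => (hspec n).2)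
    (maxEntInference_mem_intrinsicInterior u α₀) (y := y) hy hU
  obtain ⟨n, ⟨z, hzU, hz⟩, hn⟩ := (hev.and (hlim.eventually_mem hU')).exists
  have hz' : z ∈ faceAt (convexSupport u) (α n) := hz
  rw [faceAt_eq_singleton_of_mem_extremePoints hL (hα n), Set.mem_singleton_iff] at hz'
  exact Set.disjoint_left.1 hdisj hzU (hz' ▸ hn)

end MaxEnt
end

theorem mainTheorem1 :
    -- (1) and (2): the face function of a linear image `L = f(K)` of a stable convex body
    (∀ (X Y : Type*) [NormedAddCommGroup X] [NormedSpace ℝ X] [FiniteDimensional ℝ X]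
        [NormedAddCommGroup Y] [NormedSpace ℝ Y] [FiniteDimensional ℝ Y]
        (f : X →ₗ[ℝ] Y) (K : Set X) (_ : IsCompact K) (hK : Convex ℝ K) (_ : IsStable hK)
        (w : ℕ → Y) (w₀ : Y) (_ : ∀ i, w i ∈ f '' K) (_ : w₀ ∈ f '' K)
        (_ : Tendsto w atTop (𝓝 w₀))
        (v : ℕ → X) (v₀ : X) (_ : ∀ i, v i ∈ K) (_ : v₀ ∈ K)
        (_ : Tendsto v atTop (𝓝 v₀)) (_ : ∀ i, f (v i) = w i)
        (_ : v₀ ∈ intrinsicInterior ℝ (fiber f K w₀)),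
      (∀ O : Set (f '' K), IsOpen O → (∃ y ∈ O, (y : Y) ∈ faceAt (f '' K) w₀) →
          ∃ N : ℕ, ∀ i ≥ N, ∃ y ∈ O, (y : Y) ∈ faceAt (f '' K) (w i)) ∧
        (affineDim (faceAt (f '' K) w₀) : ℕ∞) ≤
          liminf (fun i => (affineDim (faceAt (f '' K) (w i)) : ℕ∞)) atTop) ∧
    -- the maximum-entropy inference is discontinuous at non-extremal limits of extremal points
    (∀ (d r : ℕ) (u : Fin r → Matrix (Fin d) (Fin d) ℂ) (_ : ∀ i, (u i).IsHermitian)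
        (α : ℕ → Fin r → ℝ) (α₀ : convexSupport u)
        (_ : ∀ n, α n ∈ (convexSupport u).extremePoints ℝ)
        (_ : Tendsto α atTop (𝓝 (α₀ : Fin r → ℝ)))
        (_ : (α₀ : Fin r → ℝ) ∉ (convexSupport u).extremePoints ℝ),
      ¬ ContinuousAt (maxEntInference u) α₀) := by
  refine ⟨?_, fun d r u _ α α₀ hα hlim hα₀ => not_continuousAt_maxEntInference u hα hlim hα₀⟩
  intro X Y _ _ _ _ _ _ f K _ hK hst w w₀ _ _ _ v v₀ hv _ hlim hvw hv₀
  refine ⟨?_, hst.affineDim_faceAt_le_liminf f hv hlim hvw hv₀⟩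
  rintro O hO ⟨y, hyO, hy⟩
  obtain ⟨U, hU, rfl⟩ := isOpen_induced_iff.1 hO
  obtain ⟨N, hN⟩ := eventually_atTop.1
    (hst.eventually_inter_faceAt_image f hv hlim hvw hv₀ hy (hU.mem_nhds hyO))
  refine ⟨N, fun i hi => ?_⟩
  obtain ⟨z, hzU, hz⟩ := hN i hi
  have hwi : w i ∈ f '' K := ⟨v i, hv i, hvw i⟩
  exact ⟨⟨z, ((mem_faceAt_iff (hK.linear_image f) hwi).1 hz).1⟩, hzU, hz⟩
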